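/- Setting. Let $\mathcal X\subset\mathbb R^m$ carry a pseudometric $d$, and let $\mathcal H$ be a reproducing kernel Hilbert space of real functions on $\mathcal X$ with (jointly measurable) kernel $k$. Let $f\in\mathcal H$ with $\|f\|_{\mathcal H}\le B$, let $R\ge0$, $\lambda>0$, $\zeta\in(0,1)$, $T\in\mathbb N$, and let $\tau\in\mathbb R$ satisfy $\tau\le\max_{x\in\mathcal X}f(x)$. For $0\le\epsilon\le\infty$ put $\Delta_\epsilon(x)=\{x'-x : x'\in\mathcal X,\ d(x,x')\le\epsilon\}$. For points $x_1,\dots,x_t$ and observations $\boldsymbol y_t=(y_1,\dots,y_t)^\top$ let $\boldsymbol K_t=(k(x_i,x_j))_{i,j\le t}$, $\boldsymbol k_t(x)=(k(x_i,x))_{i\le t}$, $\mu_t(x)=\boldsymbol k_t(x)^\top(\boldsymbol K_t+\lambda\boldsymbol I_t)^{-1}\boldsymbol y_t$, $\sigma_t^2(x)=k(x,x)-\boldsymbol k_t(x)^\top(\boldsymbol K_t+\lambda\boldsymbol I_t)^{-1}\boldsymbol k_t(x)$ (so $\mu_0=0$, $\sigma_0^2(x)=k(x,x)$). With $\overline\lambda=\max\{1,\lambda\}$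 let $$\beta_t=B+\frac{R}{\sqrt\lambda}\sqrt{\log\det\Big(\tfrac{\overline\lambda}{\lambda}\boldsymbol K_{t-1}+\overline\lambda\boldsymbol I_{t-1}\Big)+2\log\tfrac1\zeta},$$ $\mathrm{ucb}_t=\mu_{t-1}+\beta_t\sigma_{t-1}$ and $\mathrm{lcb}_t=\mu_{t-1}-\beta_t\sigma_{t-1}$. The optimistic fragility of $x\in\mathcal X$ is $$\overline\kappa_{\tau,t}(x)=\Big(\max_{\delta\in\Delta_\infty(x)\setminus 0}\frac{\tau-\mathrm{ucb}_t(x+\delta)}{d(x,x+\delta)}\Big)^+\ \text{ if } \mathrm{ucb}_t(x)\ge\tau,\qquad \overline\kappa_{\tau,t}(x)=+\infty\ \text{ otherwise,}$$ and $\overline\kappa_{\tau,t}=\min_{x\in\mathcal X}\overline\kappa_{\tau,t}(x)$; the pessimistic fragility $\underline\kappa_{\tau,t}(x)$ is defined in the same way with $\mathrm{lcb}_t$ in place of $\mathrm{ucb}_t$. (The maxima are read as suprema in $[-\infty,\infty]$; at $\delta$ with $d(x,x+\delta)=0$ the ratio is $+\infty$ if the bound at $x+\delta$ is below $\tau$,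 and $-\infty$ otherwise.) In each round $t=1,\dots,T$ AdveRS-1 selects $\tilde x_t\in\operatorname{argmin}_{x\in\mathcal X}\overline\kappa_{\tau,t}(x)$, an adversary with an arbitrary budget $\epsilon_t$ picks $\delta_t\in\Delta_{\epsilon_t}(\tilde x_t)$, and $y_t=f(x_t)+\eta_t$ is observed at $x_t=\tilde x_t+\delta_t$. For some filtration $(\mathcal F_t)$, $x_t$ is $\mathcal F_{t-1}$-measurable, $\eta_t$ is $\mathcal F_t$-measurable, and $\eta_t$ is conditionally $R$-sub-Gaussian, i.e. $\mathbb E[e^{s\eta_t}\mid\mathcal F_{t-1}]\le e^{s^2R^2/2}$ a.s. for all $s\in\mathbb R$. The maximum that defines $\overline\kappa_{\tau,t}(\tilde x_t)$ is assumed to be attained (this is required only when $\mathrm{ucb}_t(\tilde x_t)>\tau$ and $\mathrm{ucb}_t(z)<\tau$ for some $z\in\mathcal X$). Claim. With probability at least $1-\zeta$, for all $t\in\{1,\dots,T\}$: 1. if $\underline\kappa_{\tau,t}(\tilde x_t)<\infty$, then $f(\tilde x_t+\delta)\ge\tau-\underline\kappa_{\tau,t}(\tilde x_t)\,d(\tilde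 x_t,\tilde x_t+\delta)$ for all $\delta\in\Delta_\infty(\tilde x_t)$; 2. conversely, if $f(z)\le\tau$ for some $z\in\mathcal X$, then there is $\delta'\in\Delta_\infty(\tilde x_t)$ with $f(\tilde x_t+\delta')\le\tau-\overline\kappa_{\tau,t}\,d(\tilde x_t,\tilde x_t+\delta')$ (with $\infty\cdot0=0$ should $\overline\kappa_{\tau,t}=\infty$). -/

import Mathlib

open MeasureTheory
open scoped ENNReal

namespace AdveRS

noncomputable section

/-- The ambient space `ℝ^m`, of which the domain is a subset. -/
abbrev E (m : ℕ) : Type := EuclideanSpace ℝ (Fin m)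

/-- `d` is a pseudometric on `X`. -/
structure IsPseudometric {X : Type*} (d : X → X → ℝ) : Prop where
  self : ∀ x, d x x = 0
  nonneg : ∀ x y, 0 ≤ d x y
  symm : ∀ x y, d x y = d y x
  triangle : ∀ x y z, d x z ≤ d x y + d y z

/-! ### Perturbations -/

/-- The ambiguity ball `Δ_ε(x) = {x' - x : x' ∈ 𝒳, d(x, x') ≤ ε}`, for `0 ≤ ε ≤ ∞`. -/
def ambiguityBall {m : ℕ} {𝒳 : Set (E m)} (d : 𝒳 → 𝒳 → ℝ) (ε : ℝ≥0∞) (x : 𝒳) : Set (E m) :=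
  {δ | ∃ x' : 𝒳, δ = (x' : E m) - (x : E m) ∧ ENNReal.ofReal (d x x') ≤ ε}

theorem add_mem_of_mem_ambiguityBall {m : ℕ} {𝒳 : Set (E m)} {d : 𝒳 → 𝒳 → ℝ} {ε : ℝ≥0∞}
    {x : 𝒳} {δ : E m} (h : δ ∈ ambiguityBall d ε x) : (x : E m) + δ ∈ 𝒳 := by
  obtain ⟨x', rfl, -⟩ := h
  simp

/-- The perturbed point `x + δ`, as a point of `𝒳`, for a permissible perturbation `δ`. -/
def perturb {m : ℕ} {𝒳 : Set (E m)} {d : 𝒳 → 𝒳 → ℝ} {ε : ℝ≥0∞}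
    (x : 𝒳) (δ : E m) (h : δ ∈ ambiguityBall d ε x) : 𝒳 :=
  ⟨(x : E m) + δ, add_mem_of_mem_ambiguityBall h⟩

/-! ### Fragility -/

/-- The ratio `(τ - g(x')) / d(x, x')`. For a point `x'` at distance `0` from `x` the constraint
`g(x') ≥ τ - k d(x, x')` which the ratio encodes reads `g(x') ≥ τ`, whatever `k` is; so the
ratio is then `+∞` if the constraint fails and `-∞` if it holds. -/
def fragilityRatio {X : Type*} (d : X → X → ℝ) (g : X → ℝ) (τ : ℝ) (x x' : X) : EReal :=
  open Classical in
  if d x x' = 0 then (if g x' < τ then ⊤ else ⊥)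
  else (((τ - g x') / d x x' : ℝ) : EReal)

/-- The fragility of the action `x` for the reward function `g` and the threshold `τ`:
`(max_{δ ∈ Δ_∞(x) ∖ 0} (τ - g(x+δ)) / d(x, x+δ))⁺` if `g x ≥ τ`, and `+∞` otherwise.
The maximum is taken as a supremum in the extended reals, so that it always exists. -/
def fragility {m : ℕ} {𝒳 : Set (E m)} (d : 𝒳 → 𝒳 → ℝ) (g : 𝒳 → ℝ) (τ : ℝ) (x : 𝒳) : EReal :=
  open Classical in
  if τ ≤ g x then
    max (⨆ (δ : E m) (h : δ ∈ ambiguityBall d ⊤ x) (_ : δ ≠ 0),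
      fragilityRatio d g τ x (perturb x δ h)) 0
  else ⊤

/-- The maximum in the definition of the fragility of `x` is attained. -/
def FragilityMaxAttained {m : ℕ} {𝒳 : Set (E m)} (d : 𝒳 → 𝒳 → ℝ) (g : 𝒳 → ℝ) (τ : ℝ)
    (x : 𝒳) : Prop :=
  ∃ (δ : E m) (h : δ ∈ ambiguityBall d ⊤ x), δ ≠ 0 ∧
    ∀ (δ' : E m) (h' : δ' ∈ ambiguityBall d ⊤ x), δ' ≠ 0 →
      fragilityRatio d g τ x (perturb x δ' h') ≤ fragilityRatio d g τ x (perturb x δ h)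

/-! ### Gaussian process posterior and confidence bounds -/

/-- The real-valued reproducing kernel `k(x, x')` of the space `H` of real functions on `X`. -/
def kern {X : Type*} (H : Type*) [NormedAddCommGroup H] [InnerProductSpace ℝ H] [CompleteSpace H]
    [RKHS ℝ H X ℝ] (x x' : X) : ℝ :=
  RKHS.kernel H x x' 1

/-- The kernel matrix of the points `x₁, …, xₙ`. -/
def gram {X : Type*} (k : X → X → ℝ) {n : ℕ} (x : Fin n → X) : Matrix (Fin n) (Fin n) ℝ :=
  Matrix.of fun i j => k (x i) (x j)

/-- The vector `(k(xᵢ, z))ᵢ`. -/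
def kvec {X : Type*} (k : X → X → ℝ) {n : ℕ} (x : Fin n → X) (z : X) : Fin n → ℝ :=
  fun i => k (x i) z

/-- Posterior mean after the observations `(xᵢ, yᵢ)`. -/
def postMean {X : Type*} (k : X → X → ℝ) (lam : ℝ) {n : ℕ} (x : Fin n → X) (y : Fin n → ℝ)
    (z : X) : ℝ :=
  kvec k x z ⬝ᵥ ((gram k x + lam • (1 : Matrix (Fin n) (Fin n) ℝ))⁻¹.mulVec y)

/-- Posterior covariance after observations at the points `xᵢ`. -/
def postCov {X : Type*} (k : X → X → ℝ) (lam : ℝ) {n : ℕ} (x : Fin n → X) (z z' : X) : ℝ :=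
  k z z' -
    kvec k x z ⬝ᵥ ((gram k x + lam • (1 : Matrix (Fin n) (Fin n) ℝ))⁻¹.mulVec (kvec k x z'))

/-- Posterior standard deviation. -/
def postStd {X : Type*} (k : X → X → ℝ) (lam : ℝ) {n : ℕ} (x : Fin n → X) (z : X) : ℝ :=
  √(postCov k lam x z z)

/-- The exploration parameter `β`, computed from the points sampled so far. -/
def beta {X : Type*} (k : X → X → ℝ) (lam B R ζ : ℝ) {n : ℕ} (x : Fin n → X) : ℝ :=
  B + R / √lam *
    √(Real.log (((max 1 lam / lam) • gram k x +
        (max 1 lam) • (1 : Matrix (Fin n) (Fin n) ℝ)).det) + 2 * Real.log (1 / ζ))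

/-- Upper confidence bound, computed from the data observed so far. -/
def ucb {X : Type*} (k : X → X → ℝ) (lam B R ζ : ℝ) {n : ℕ} (x : Fin n → X) (y : Fin n → ℝ)
    (z : X) : ℝ :=
  postMean k lam x y z + beta k lam B R ζ x * postStd k lam x z

/-- Lower confidence bound, computed from the data observed so far. -/
def lcb {X : Type*} (k : X → X → ℝ) (lam B R ζ : ℝ) {n : ℕ} (x : Fin n → X) (y : Fin n → ℝ)
    (z : X) : ℝ :=
  postMean k lam x y z - beta k lam B R ζ x * postStd k lam x z

/-! ### Interaction protocol

Rounds are numbered from `0`: the `t`-th round is preceded by exactly `t` observations. -/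

/-- The first `t` terms of a random sequence, at the outcome `ω`. -/
def past {Ω A : Type*} (a : ℕ → Ω → A) (t : ℕ) (ω : Ω) : Fin t → A :=
  fun i => a i ω

/-- The upper confidence bound used in round `t`. -/
def ucbAt {Ω X : Type*} (k : X → X → ℝ) (lam B R ζ : ℝ) (x : ℕ → Ω → X) (y : ℕ → Ω → ℝ)
    (t : ℕ) (ω : Ω) : X → ℝ :=
  ucb k lam B R ζ (past x t ω) (past y t ω)

/-- The lower confidence bound used in round `t`. -/
def lcbAt {Ω X : Type*} (k : X → X → ℝ) (lam B R ζ : ℝ) (x : ℕ → Ω → X) (y : ℕ → Ω → ℝ)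
    (t : ℕ) (ω : Ω) : X → ℝ :=
  lcb k lam B R ζ (past x t ω) (past y t ω)

/-- `T` rounds of AdveRS-1 against an adversary with perturbation budgets `ε t`: in round `t` the
learner selects the action `xsel t`, a minimizer of the optimistic fragility, the adversary
perturbs it by `δ t`, and the noisy value `y t` of `f` at the perturbed point `x t` is observed. -/
structure IsAdveRS1Run {m : ℕ} {𝒳 : Set (E m)} {Ω : Type*} (d : 𝒳 → 𝒳 → ℝ) (k : 𝒳 → 𝒳 → ℝ)
    (lam B R ζ τ : ℝ) (f : 𝒳 → ℝ) (T : ℕ) (ε : ℕ → ℝ≥0∞) (xsel : ℕ → Ω → 𝒳) (δ : ℕ → Ω → E m)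
    (x : ℕ → Ω → 𝒳) (η : ℕ → Ω → ℝ) (y : ℕ → Ω → ℝ) : Prop where
  select : ∀ t < T, ∀ ω, ∀ z : 𝒳,
    fragility d (ucbAt k lam B R ζ x y t ω) τ (xsel t ω) ≤
      fragility d (ucbAt k lam B R ζ x y t ω) τ z
  perturbation : ∀ t < T, ∀ ω, δ t ω ∈ ambiguityBall d (ε t) (xsel t ω)
  sample : ∀ t < T, ∀ ω, (x t ω : E m) = (xsel t ω : E m) + δ t ω
  observe : ∀ t < T, ∀ ω, y t ω = f (x t ω) + η t ω

/-- `X` is conditionally `R`-sub-Gaussian given the σ-algebra `𝓖`: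
`𝔼[exp (s X) | 𝓖] ≤ exp (s² R² / 2)` almost surely, for every real `s`. -/
def IsCondSubGaussian {Ω : Type*} {mΩ : MeasurableSpace Ω} (P : Measure Ω)
    (𝓖 : MeasurableSpace Ω) (X : Ω → ℝ) (R : ℝ) : Prop :=
  ∀ s : ℝ, Integrable (fun ω => Real.exp (s * X ω)) P ∧
    ∀ᵐ ω ∂P, (P[fun ω' => Real.exp (s * X ω') | 𝓖]) ω ≤ Real.exp (s ^ 2 * R ^ 2 / 2)

end

end AdveRS

/-! Everything reduces to one event, of probability at least 1 - ζ, on which |f - μ| ≤ β σ at every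
point and in every round, so that lcb ≤ f ≤ ucb. The rest is deterministic. A finite fragility κ of
lcb says lcb ≥ τ - κ d around the action, and f lies above lcb (`le_of_fragility_ne_top`). For ucb,
the selected action minimizes the fragility, and at a maximizing perturbation ucb equals τ - κ d
when the distance is positive, while f lies below ucb; the degenerate cases are treated by hand
(`exists_le_sub_fragility_mul`).

For the event, let w be the posterior weights at z. The error f(z) - μ(z) is a bias, the inner
product of f with a residual of norm at most σ(z), minus the noise term w·η. By Cauchy–Schwarz,
λ(w·η)² ≤ σ²(z) E, where E = ηᵀK(K + λI)⁻¹η (`sq_weights_dotProduct_le`).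

The energy E is controlled by the method of mixtures, one observation at a time. The process det(I +
K/λ)^(-1/2) exp(E/(2R²)) is multiplied in each round by a Gaussian average of exp(uη - u²R²/2) with
predictable u (`lintegral_exp_gaussianReal_mixture`). Sub-Gaussianity makes it a supermartingale
started at 1, and Ville's inequality at level 1/ζ bounds E in all rounds at once. -/

namespace AdveRS

/-! ### Features and the regularized kernel matrix -/

section Kernel

variable {X H : Type*} [NormedAddCommGroup H] [InnerProductSpace ℝ H] [CompleteSpace H]
  [RKHS ℝ H X ℝ]

/-- The feature `k(·, x)` of a point, as an element of the reproducing kernel Hilbert space. -/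
noncomputable def feature (H : Type*) [NormedAddCommGroup H] [InnerProductSpace ℝ H]
    [CompleteSpace H] [RKHS ℝ H X ℝ] (x : X) : H :=
  RKHS.kerFun H x 1

theorem kern_eq_inner (x x' : X) : kern H x x' = inner ℝ (feature H x) (feature H x') := by
  have h := RKHS.kernel_inner H x x' 1 1
  rw [real_inner_comm, feature, feature, ← h]
  simp [kern]

theorem kern_comm (x x' : X) : kern H x x' = kern H x' x := by
  rw [kern_eq_inner, kern_eq_inner, real_inner_comm]

theorem inner_feature (f : H) (x : X) : inner ℝ f (feature H x) = f x := by
  simp [feature]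

theorem gram_kern_eq {n : ℕ} (x : Fin n → X) :
    gram (kern H) x = Matrix.gram ℝ (fun i => feature H (x i)) := by
  ext i j
  simp [gram, Matrix.gram, kern_eq_inner]

/-- The regularized kernel matrix `K + λ I`. -/
noncomputable def regGram (k : X → X → ℝ) (lam : ℝ) {n : ℕ} (x : Fin n → X) :
    Matrix (Fin n) (Fin n) ℝ :=
  gram k x + lam • (1 : Matrix (Fin n) (Fin n) ℝ)

theorem posDef_regGram {lam : ℝ} (hlam : 0 < lam) {n : ℕ} (x : Fin n → X) :
    (regGram (kern H) lam x).PosDef := by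
  rw [regGram, gram_kern_eq]
  exact Matrix.PosDef.posSemidef_add (Matrix.posSemidef_gram ℝ _) (Matrix.PosDef.one.smul hlam)

theorem det_regGram_pos {lam : ℝ} (hlam : 0 < lam) {n : ℕ} (x : Fin n → X) :
    0 < (regGram (kern H) lam x).det :=
  (posDef_regGram hlam x).det_pos

theorem regGram_mulVec_inv {lam : ℝ} (hlam : 0 < lam) {n : ℕ} (x : Fin n → X) (v : Fin n → ℝ) :
    (regGram (kern H) lam x).mulVec ((regGram (kern H) lam x)⁻¹.mulVec v) = v := by
  rw [Matrix.mulVec_mulVec, Matrix.mul_nonsing_inv _ (det_regGram_pos hlam x).ne'.isUnit,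
    Matrix.one_mulVec]

theorem regGram_inv_mulVec_eq {lam : ℝ} (hlam : 0 < lam) {n : ℕ} (x : Fin n → X)
    {v w : Fin n → ℝ} (h : (regGram (kern H) lam x).mulVec w = v) :
    (regGram (kern H) lam x)⁻¹.mulVec v = w := by
  rw [← h, Matrix.mulVec_mulVec, Matrix.nonsing_inv_mul _ (det_regGram_pos hlam x).ne'.isUnit,
    Matrix.one_mulVec]

theorem regGram_mulVec (k : X → X → ℝ) (lam : ℝ) {n : ℕ} (x : Fin n → X) (v : Fin n → ℝ) :
    (regGram k lam x).mulVec v = (gram k x).mulVec v + lam • v := by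
  simp [regGram, Matrix.add_mulVec, Matrix.smul_mulVec]

theorem isSymm_regGram (lam : ℝ) {n : ℕ} (x : Fin n → X) :
    (regGram (kern H) lam x).IsSymm := by
  ext i j
  simp [regGram, gram, kern_comm (x i), Matrix.one_apply, eq_comm]

theorem dotProduct_regGram_inv_comm (lam : ℝ) {n : ℕ} (x : Fin n → X) (v w : Fin n → ℝ) :
    v ⬝ᵥ (regGram (kern H) lam x)⁻¹.mulVec w = w ⬝ᵥ (regGram (kern H) lam x)⁻¹.mulVec v := by
  rw [Matrix.dotProduct_mulVec, dotProduct_comm, ← Matrix.mulVec_transpose,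
    Matrix.transpose_nonsing_inv, (isSymm_regGram lam x).eq]

theorem inner_sum_feature {n : ℕ} (x : Fin n → X) (f : H) (v : Fin n → ℝ) :
    inner ℝ f (∑ i, v i • feature H (x i)) = v ⬝ᵥ fun i => f (x i) := by
  simp [inner_sum, inner_smul_right, inner_feature, dotProduct]

theorem sum_feature_apply {n : ℕ} (x : Fin n → X) (v : Fin n → ℝ) (z : X) :
    (∑ i, v i • feature H (x i)) z = v ⬝ᵥ kvec (kern H) x z := by
  rw [← inner_feature, sum_inner]
  simp [inner_smul_left, kern_eq_inner, dotProduct, kvec]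

theorem sum_feature_comp {n : ℕ} (x : Fin n → X) (v : Fin n → ℝ) :
    (fun i => (∑ i, v i • feature H (x i)) (x i)) = (gram (kern H) x).mulVec v := by
  ext j
  rw [sum_feature_apply, dotProduct_comm]
  simp [Matrix.mulVec, dotProduct, kvec, gram, kern_comm (x j)]

end Kernel

/-! ### Posterior mean and variance in feature space -/

section Posterior

variable {X H : Type*} [NormedAddCommGroup H] [InnerProductSpace ℝ H] [CompleteSpace H]
  [RKHS ℝ H X ℝ] {lam : ℝ} {n : ℕ}

/-- The weights `(K + λ I)⁻¹ k(z)` of the observations in the posterior mean at `z`. -/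
noncomputable def weights (H : Type*) [NormedAddCommGroup H] [InnerProductSpace ℝ H]
    [CompleteSpace H] [RKHS ℝ H X ℝ] (lam : ℝ) (x : Fin n → X) (z : X) : Fin n → ℝ :=
  (regGram (kern H) lam x)⁻¹.mulVec (kvec (kern H) x z)

/-- The feature at `z` minus its approximation by the features at the observed points. -/
noncomputable def residual (H : Type*) [NormedAddCommGroup H] [InnerProductSpace ℝ H]
    [CompleteSpace H] [RKHS ℝ H X ℝ] (lam : ℝ) (x : Fin n → X) (z : X) : H :=
  feature H z - ∑ i, weights H lam x z i • feature H (x i)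

theorem postMean_eq_weights (x : Fin n → X) (y : Fin n → ℝ) (z : X) :
    postMean (kern H) lam x y z = weights H lam x z ⬝ᵥ y := by
  rw [postMean, ← regGram, dotProduct_regGram_inv_comm, dotProduct_comm, weights]

/-- The weights w solve Kw = k(z) - λw; substituting this in the expanded square of the residual
leaves k(z,z) - w·k(z) - λ w·w. Both the nonnegativity of the variance and the bound of the residual
by σ come from here. -/
theorem postCov_self_eq (hlam : 0 < lam) (x : Fin n → X) (z : X) :
    postCov (kern H) lam x z z =
      ‖residual H lam x z‖ ^ 2 + lam * (weights H lam x z ⬝ᵥ weights H lam x z) := by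
  have h1 : (gram (kern H) x).mulVec (weights H lam x z) =
      kvec (kern H) x z - lam • weights H lam x z := by
    rw [eq_sub_iff_add_eq, ← regGram_mulVec, weights, regGram_mulVec_inv hlam]
  rw [postCov, ← regGram, ← weights, residual, norm_sub_sq_real, ← real_inner_self_eq_norm_sq,
    ← real_inner_self_eq_norm_sq, inner_sum_feature, inner_sum_feature, sum_feature_comp, h1,
    ← kern_eq_inner]
  have h2 : (fun i => feature H z (x i)) = kvec (kern H) x z := by
    ext i
    rw [← inner_feature, ← kern_eq_inner, kvec, kern_comm]
  rw [h2, dotProduct_sub, dotProduct_smul, dotProduct_comm (kvec _ _ _), smul_eq_mul]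
  ring

theorem postCov_self_nonneg (hlam : 0 < lam) (x : Fin n → X) (z : X) :
    0 ≤ postCov (kern H) lam x z z := by
  rw [postCov_self_eq hlam]
  have : 0 ≤ weights H lam x z ⬝ᵥ weights H lam x z := by
    simpa using dotProduct_star_self_nonneg (weights H lam x z)
  positivity

theorem norm_residual_le_postStd (hlam : 0 < lam) (x : Fin n → X) (z : X) :
    ‖residual H lam x z‖ ≤ postStd (kern H) lam x z := by
  refine Real.le_sqrt_of_sq_le ?_
  have : 0 ≤ weights H lam x z ⬝ᵥ weights H lam x z := by
    simpa using dotProduct_star_self_nonneg (weights H lam x z)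
  rw [postCov_self_eq hlam]
  nlinarith [mul_nonneg hlam.le this]

theorem abs_sub_weights_dotProduct_le (hlam : 0 < lam) (x : Fin n → X) (f : H) (z : X) :
    |f z - weights H lam x z ⬝ᵥ fun i => f (x i)| ≤ ‖f‖ * postStd (kern H) lam x z := by
  have h : f z - weights H lam x z ⬝ᵥ (fun i => f (x i)) = inner ℝ f (residual H lam x z) := by
    rw [residual, inner_sub_right, inner_feature, inner_sum_feature]
  rw [h]
  exact (abs_real_inner_le_norm _ _).trans
    (mul_le_mul_of_nonneg_left (norm_residual_le_postStd hlam x z) (norm_nonneg _))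

/-- The quadratic form `ηᵀ K (K + λ I)⁻¹ η = |η|² - λ ηᵀ (K + λ I)⁻¹ η` of a noise vector. -/
noncomputable def noiseEnergy (k : X → X → ℝ) (lam : ℝ) (x : Fin n → X) (η : Fin n → ℝ) : ℝ :=
  η ⬝ᵥ η - lam * (η ⬝ᵥ (regGram k lam x)⁻¹.mulVec η)

theorem sq_dotProduct_le (v w : Fin n → ℝ) : (v ⬝ᵥ w) ^ 2 ≤ (v ⬝ᵥ v) * (w ⬝ᵥ w) := by
  simpa [dotProduct, sq] using Finset.sum_mul_sq_le_sq_mul_sq Finset.univ v w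

/-- The Cauchy–Schwarz bound on the contribution of the noise to the posterior mean. -/
theorem sq_weights_dotProduct_le (hlam : 0 < lam) (x : Fin n → X) (η : Fin n → ℝ) (z : X) :
    lam * (weights H lam x z ⬝ᵥ η) ^ 2 ≤
      postCov (kern H) lam x z z * noiseEnergy (kern H) lam x η := by
  set a : Fin n → ℝ := (regGram (kern H) lam x)⁻¹.mulVec η with ha
  set h : H := ∑ i, a i • feature H (x i) with hh
  set b : Fin n → ℝ := (gram (kern H) x).mulVec a with hb
  set w := weights H lam x z with hw
  set r := residual H lam x z with hr
  -- Kernel ridge regression on the noise: `h` is the fitted function, `b` its values at the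
  -- samples, and `lam • a` what the fit leaves over.
  have hη : η = b + lam • a := by rw [hb, ← regGram_mulVec, ha, regGram_mulVec_inv hlam]
  have hcomp : (fun i => h (x i)) = b := by rw [hh, sum_feature_comp]
  have hhh : ‖h‖ ^ 2 = a ⬝ᵥ b := by
    rw [← real_inner_self_eq_norm_sq]
    conv_lhs => arg 2; rw [hh]
    rw [inner_sum_feature, hcomp]
  have hE : noiseEnergy (kern H) lam x η = b ⬝ᵥ b + lam * ‖h‖ ^ 2 := by
    rw [noiseEnergy, ← ha, hhh, hη]
    simp only [add_dotProduct, dotProduct_add, smul_dotProduct, dotProduct_smul, smul_eq_mul,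
      dotProduct_comm b a]
    ring
  -- Both sides equal h(z), by the symmetry of (K + λI)⁻¹.
  have hwη : w ⬝ᵥ η = inner ℝ h r + w ⬝ᵥ b := by
    rw [hr, residual, inner_sub_right, inner_feature, inner_sum_feature, hcomp, ← hw,
      sub_add_cancel, hh, sum_feature_apply, hw, weights, dotProduct_comm,
      dotProduct_regGram_inv_comm, dotProduct_comm]
  have h1 : |inner ℝ h r| ≤ ‖h‖ * ‖r‖ := abs_real_inner_le_norm _ _
  have h2 : (w ⬝ᵥ b) ^ 2 ≤ (w ⬝ᵥ w) * (b ⬝ᵥ b) := sq_dotProduct_le w b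
  have hww : 0 ≤ w ⬝ᵥ w := by simpa using dotProduct_star_self_nonneg w
  have hbb : 0 ≤ b ⬝ᵥ b := by simpa using dotProduct_star_self_nonneg b
  have h3 : |w ⬝ᵥ b| ≤ √(w ⬝ᵥ w) * √(b ⬝ᵥ b) := by
    rw [← Real.sqrt_mul hww]
    exact Real.abs_le_sqrt h2
  rw [postCov_self_eq hlam, hE, hwη, ← hr, ← hw]
  set p := √(w ⬝ᵥ w) with hp
  set q := √(b ⬝ᵥ b) with hq
  have hp2 : w ⬝ᵥ w = p ^ 2 := (Real.sq_sqrt hww).symm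
  have hq2 : b ⬝ᵥ b = q ^ 2 := (Real.sq_sqrt hbb).symm
  have h4 : (inner ℝ h r + w ⬝ᵥ b) ^ 2 ≤ (‖h‖ * ‖r‖ + p * q) ^ 2 := by
    rw [← sq_abs]
    exact pow_le_pow_left₀ (abs_nonneg _) ((abs_add_le _ _).trans (add_le_add h1 h3)) 2
  rw [hp2, hq2]
  calc lam * (inner ℝ h r + w ⬝ᵥ b) ^ 2 ≤ lam * (‖h‖ * ‖r‖ + p * q) ^ 2 := by gcongr
    -- Lagrange's identity: the difference of the two sides is exactly this square.
    _ ≤ _ := by nlinarith [sq_nonneg (‖r‖ * q - lam * p * ‖h‖)]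

theorem abs_weights_dotProduct_le (hlam : 0 < lam) (x : Fin n → X) (η : Fin n → ℝ) (z : X)
    {C : ℝ} (hC : 0 ≤ C) (hE : noiseEnergy (kern H) lam x η ≤ C ^ 2) :
    |weights H lam x z ⬝ᵥ η| ≤ C / √lam * postStd (kern H) lam x z := by
  have h := sq_weights_dotProduct_le (H := H) hlam x η z
  have hs := postCov_self_nonneg (H := H) hlam x z
  refine abs_le_of_sq_le_sq ?_ (mul_nonneg (by positivity) (Real.sqrt_nonneg _))
  rw [mul_pow, div_pow, Real.sq_sqrt hlam.le, postStd, Real.sq_sqrt hs, div_mul_eq_mul_div,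
    le_div_iff₀ hlam, mul_comm]
  exact h.trans (by rw [mul_comm]; gcongr)

end Posterior

/-! ### Adding one observation -/

section Extend

variable {X H : Type*} [NormedAddCommGroup H] [InnerProductSpace ℝ H] [CompleteSpace H]
  [RKHS ℝ H X ℝ] {lam : ℝ} {n : ℕ}

theorem regGram_snoc_mulVec (x : Fin n → X) (z : X) (v : Fin n → ℝ) (c : ℝ) :
    (regGram (kern H) lam (Fin.snoc x z : Fin (n + 1) → X)).mulVec (Fin.snoc v c) =
      Fin.snoc ((regGram (kern H) lam x).mulVec v + c • kvec (kern H) x z)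
        (kvec (kern H) x z ⬝ᵥ v + c * (kern H z z + lam)) := by
  ext i
  rw [regGram_mulVec, regGram_mulVec]
  refine Fin.lastCases ?_ (fun i => ?_) i
  · simp [Matrix.mulVec, dotProduct, Fin.sum_univ_castSucc, gram, kvec, kern_comm z]
    ring
  · simp [Matrix.mulVec, dotProduct, Fin.sum_univ_castSucc, gram, kvec]
    ring

/-- Block elimination: the Schur complement of the old block is σ²(z) + λ. -/
theorem regGram_snoc_mulVec_solution (hlam : 0 < lam) (x : Fin n → X) (z : X) (v : Fin n → ℝ)
    (c : ℝ) :
    (regGram (kern H) lam (Fin.snoc x z : Fin (n + 1) → X)).mulVec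
        (Fin.snoc ((regGram (kern H) lam x)⁻¹.mulVec v - c • weights H lam x z) c) =
      Fin.snoc v (weights H lam x z ⬝ᵥ v + c * (postCov (kern H) lam x z z + lam)) := by
  rw [regGram_snoc_mulVec]
  congr 1
  · rw [Matrix.mulVec_sub, Matrix.mulVec_smul, weights, regGram_mulVec_inv hlam,
      regGram_mulVec_inv hlam, sub_add_cancel]
  · rw [dotProduct_sub, dotProduct_smul, dotProduct_regGram_inv_comm, ← weights,
      dotProduct_comm v, postCov, ← regGram, ← weights, smul_eq_mul]
    ring

theorem inv_regGram_snoc_mulVec (hlam : 0 < lam) (x : Fin n → X) (z : X) (v : Fin n → ℝ) (e : ℝ) :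
    (regGram (kern H) lam (Fin.snoc x z : Fin (n + 1) → X))⁻¹.mulVec (Fin.snoc v e) =
      Fin.snoc ((regGram (kern H) lam x)⁻¹.mulVec v -
          ((e - weights H lam x z ⬝ᵥ v) / (postCov (kern H) lam x z z + lam)) • weights H lam x z)
        ((e - weights H lam x z ⬝ᵥ v) / (postCov (kern H) lam x z z + lam)) := by
  apply regGram_inv_mulVec_eq hlam
  have := postCov_self_nonneg (H := H) hlam x z
  rw [regGram_snoc_mulVec_solution hlam, div_mul_cancel₀ _ (by positivity), add_sub_cancel]

theorem det_regGram_snoc (hlam : 0 < lam) (x : Fin n → X) (z : X) :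
    (regGram (kern H) lam (Fin.snoc x z : Fin (n + 1) → X)).det =
      (regGram (kern H) lam x).det * (postCov (kern H) lam x z z + lam) := by
  have hs := postCov_self_nonneg (H := H) hlam x z
  set A := regGram (kern H) lam (Fin.snoc x z : Fin (n + 1) → X) with hA
  have hd : 0 < A.det := det_regGram_pos hlam _
  -- The last diagonal entry of the inverse is 1/(σ²(z) + λ) by elimination, and by Cramer's rule
  -- the ratio of the old determinant to the new one.
  have h1 := congrFun (inv_regGram_snoc_mulVec (H := H) hlam x z 0 1) (Fin.last n)
  have h2 : (Fin.snoc (0 : Fin n → ℝ) 1 : Fin (n + 1) → ℝ) = Pi.single (Fin.last n) 1 := by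
    ext i
    refine Fin.lastCases ?_ (fun i => ?_) i
    · simp
    · simp [Fin.castSucc_ne_last]
  rw [h2, Matrix.mulVec_single_one, Fin.snoc_last, dotProduct_zero, sub_zero, ← hA,
    Matrix.col_apply, Matrix.inv_def, Matrix.smul_apply, Matrix.adjugate_fin_succ_eq_det_submatrix,
    Ring.inverse_eq_inv'] at h1
  have h3 : A.submatrix (Fin.last n).succAbove (Fin.last n).succAbove =
      regGram (kern H) lam x := by
    ext i j
    simp [hA, regGram, gram, Matrix.one_apply]
  rw [h3] at h1
  have h4 : (-1 : ℝ) ^ ((Fin.last n : ℕ) + (Fin.last n : ℕ)) = 1 := Even.neg_one_pow ⟨_, rfl⟩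
  rw [h4, one_mul, smul_eq_mul] at h1
  field_simp at h1
  linarith

theorem noiseEnergy_snoc (hlam : 0 < lam) (x : Fin n → X) (z : X) (v : Fin n → ℝ) (e : ℝ) :
    noiseEnergy (kern H) lam (Fin.snoc x z : Fin (n + 1) → X) (Fin.snoc v e) =
      noiseEnergy (kern H) lam x v + (e ^ 2 -
        lam * (e - weights H lam x z ⬝ᵥ v) ^ 2 / (postCov (kern H) lam x z z + lam)) := by
  have hs := postCov_self_nonneg (H := H) hlam x z
  have key : ∀ (a b : Fin n → ℝ) (c d : ℝ),
      (Fin.snoc a c : Fin (n + 1) → ℝ) ⬝ᵥ (Fin.snoc b d : Fin (n + 1) → ℝ) = a ⬝ᵥ b + c * d := by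
    intro a b c d
    simp [dotProduct, Fin.sum_univ_castSucc]
  rw [noiseEnergy, inv_regGram_snoc_mulVec hlam, key, key, noiseEnergy, dotProduct_sub,
    dotProduct_smul, dotProduct_comm v (weights H lam x z), smul_eq_mul]
  ring

end Extend

/-! ### The Gaussian mixture behind one step -/

section Gaussian

open ProbabilityTheory

/-- Completing the square in g. The integrand is the likelihood ratio at e of N(θ, R²) to N(0, R²),
with drift θ = m + R√(s/λ) g. In the application m and s are the posterior mean of the noise and the
posterior variance at the new point, and the value is the one-step factor of `selfNormalized_snoc`.
-/
theorem lintegral_exp_gaussianReal_mixture {lam s R : ℝ} (hlam : 0 < lam) (hs : 0 ≤ s) (hR : 0 < R)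
    (m e : ℝ) :
    ∫⁻ g, ENNReal.ofReal (Real.exp ((m + R * √(s / lam) * g) / R ^ 2 * e -
        ((m + R * √(s / lam) * g) / R ^ 2) ^ 2 * R ^ 2 / 2)) ∂(gaussianReal 0 1) =
      ENNReal.ofReal (√(lam / (s + lam)) *
        Real.exp ((e ^ 2 - lam * (e - m) ^ 2 / (s + lam)) / (2 * R ^ 2))) := by
  set a := √(s / lam) with ha
  have ha2 : a ^ 2 = s / lam := Real.sq_sqrt (by positivity)
  set C := √(lam / (s + lam)) *
        Real.exp ((e ^ 2 - lam * (e - m) ^ 2 / (s + lam)) / (2 * R ^ 2)) with hC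
  have hvpos : 0 < lam / (s + lam) := by positivity
  set v : NNReal := ⟨lam / (s + lam), hvpos.le⟩ with hv
  have hvcoe : (v : ℝ) = lam / (s + lam) := rfl
  have hv0 : v ≠ 0 := fun h => hvpos.ne' (by rw [← hvcoe, h, NNReal.coe_zero])
  -- Mean of g after completing the square; the variance is `v` = 1/(1 + a²).
  set c : ℝ := lam / (s + lam) * a * (e - m) / R with hc
  have hpt : ∀ g : ℝ, gaussianPDF 0 1 g * ENNReal.ofReal (Real.exp ((m + R * a * g) / R ^ 2 * e -
        ((m + R * a * g) / R ^ 2) ^ 2 * R ^ 2 / 2)) =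
      ENNReal.ofReal C * gaussianPDF c v g := by
    intro g
    rw [gaussianPDF, gaussianPDF, ← ENNReal.ofReal_mul (gaussianPDFReal_nonneg _ _ _),
      ← ENNReal.ofReal_mul (by positivity)]
    congr 1
    rw [gaussianPDFReal, gaussianPDFReal, hC, hvcoe, Real.sqrt_mul (by positivity) (lam / (s + lam))]
    have hsq : √(lam / (s + lam)) ≠ 0 := (Real.sqrt_pos.2 hvpos).ne'
    have hexp : -(g - 0) ^ 2 / (2 * ((1 : NNReal) : ℝ)) + ((m + R * a * g) / R ^ 2 * e -
        ((m + R * a * g) / R ^ 2) ^ 2 * R ^ 2 / 2) =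
        (e ^ 2 - lam * (e - m) ^ 2 / (s + lam)) / (2 * R ^ 2) +
          -(g - c) ^ 2 / (2 * (lam / (s + lam))) := by
      have hs' : s = a ^ 2 * lam := by rw [ha2]; field_simp
      have h1 : lam / (s + lam) = 1 / (a ^ 2 + 1) := by
        rw [hs']; field_simp
      have h2 : lam * (e - m) ^ 2 / (s + lam) = (e - m) ^ 2 / (a ^ 2 + 1) := by
        rw [hs']; field_simp
      rw [h2, hc, h1]
      simp only [NNReal.coe_one]
      field_simp
      ring
    simp only [NNReal.coe_one, mul_one] at hexp ⊢
    rw [mul_assoc, ← Real.exp_add, hexp, Real.exp_add]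
    field_simp
  rw [gaussianReal_of_var_ne_zero _ one_ne_zero,
    lintegral_withDensity_eq_lintegral_mul _ (measurable_gaussianPDF _ _) (by fun_prop)]
  simp only [Pi.mul_apply, hpt]
  rw [lintegral_const_mul _ (measurable_gaussianPDF _ _), lintegral_gaussianPDF_eq_one _ hv0,
    mul_one]

end Gaussian

/-! ### Conditional sub-Gaussianity with predictable multipliers -/

section SubGaussian

variable {Ω : Type*} {𝓖 mΩ : MeasurableSpace Ω} {P : Measure Ω} [IsProbabilityMeasure P]
  {η : Ω → ℝ} {R : ℝ}

theorem setLIntegral_exp_le (h𝓖 : 𝓖 ≤ mΩ) (hsub : IsCondSubGaussian P 𝓖 η R) (s : ℝ)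
    {A : Set Ω} (hA : MeasurableSet[𝓖] A) :
    ∫⁻ ω in A, ENNReal.ofReal (Real.exp (s * η ω - s ^ 2 * R ^ 2 / 2)) ∂P ≤ P A := by
  obtain ⟨hint, hle⟩ := hsub s
  have h1 : ∀ ω, Real.exp (s * η ω - s ^ 2 * R ^ 2 / 2) =
      Real.exp (s * η ω) * Real.exp (-(s ^ 2 * R ^ 2 / 2)) := by
    intro ω
    rw [← Real.exp_add, sub_eq_add_neg]
  simp only [h1]
  rw [← ofReal_integral_eq_lintegral_ofReal (hint.mul_const _).integrableOn
    (Filter.Eventually.of_forall fun ω => by positivity), integral_mul_const,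
    ← setIntegral_condExp h𝓖 hint hA]
  have h2 : ∫ ω in A, (P[fun ω' => Real.exp (s * η ω') | 𝓖]) ω ∂P ≤
      ∫ _ in A, Real.exp (s ^ 2 * R ^ 2 / 2) ∂P := by
    refine integral_mono_ae integrable_condExp.integrableOn (integrable_const _) ?_
    exact ae_restrict_of_ae hle
  rw [setIntegral_const, smul_eq_mul] at h2
  calc _ ≤ ENNReal.ofReal (P.real A * Real.exp (s ^ 2 * R ^ 2 / 2) *
        Real.exp (-(s ^ 2 * R ^ 2 / 2))) := by
        apply ENNReal.ofReal_le_ofReal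
        gcongr
    _ = P A := by
        rw [mul_assoc, ← Real.exp_add, add_neg_cancel, Real.exp_zero, mul_one]
        simp

/-- On 𝓖 the measure with the exponential as density is dominated by P, so integrals of 𝓖-measurable
weights compare without any integrability of `W`. -/
theorem lintegral_mul_exp_const_le (h𝓖 : 𝓖 ≤ mΩ) (hη : Measurable η)
    (hsub : IsCondSubGaussian P 𝓖 η R) (s : ℝ) {W : Ω → ℝ≥0∞} (hW : Measurable[𝓖] W) :
    ∫⁻ ω, W ω * ENNReal.ofReal (Real.exp (s * η ω - s ^ 2 * R ^ 2 / 2)) ∂P ≤ ∫⁻ ω, W ω ∂P := by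
  set Z : Ω → ℝ≥0∞ := fun ω => ENNReal.ofReal (Real.exp (s * η ω - s ^ 2 * R ^ 2 / 2)) with hZ
  have hZm : Measurable Z := by fun_prop
  have h1 : ∫⁻ ω, W ω * Z ω ∂P = ∫⁻ ω, W ω ∂(P.withDensity Z) := by
    rw [lintegral_withDensity_eq_lintegral_mul _ hZm (hW.mono h𝓖 le_rfl)]
    simp [mul_comm]
  rw [h1, ← lintegral_trim h𝓖 hW, ← lintegral_trim (μ := P) h𝓖 hW]
  refine lintegral_mono' (Measure.le_iff.2 fun A hA => ?_) le_rfl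
  rw [trim_measurableSet_eq h𝓖 hA, trim_measurableSet_eq h𝓖 hA, withDensity_apply _ (h𝓖 _ hA)]
  exact setLIntegral_exp_le h𝓖 hsub s hA

theorem lintegral_mul_exp_le_of_finite (h𝓖 : 𝓖 ≤ mΩ) (hη : Measurable η)
    (hsub : IsCondSubGaussian P 𝓖 η R) {W : Ω → ℝ≥0∞} (hW : Measurable[𝓖] W)
    {u : Ω → ℝ} (hu : Measurable[𝓖] u) (S : Finset ℝ) (huS : ∀ ω, u ω ∈ S) :
    ∫⁻ ω, W ω * ENNReal.ofReal (Real.exp (u ω * η ω - u ω ^ 2 * R ^ 2 / 2)) ∂P ≤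
      ∫⁻ ω, W ω ∂P := by
  have hWs : ∀ s : ℝ, Measurable[𝓖] ((u ⁻¹' {s}).indicator W) := fun s =>
    hW.indicator (hu (measurableSet_singleton s))
  have hsum : ∀ (F : Ω → ℝ → ℝ≥0∞) (ω : Ω), W ω * F ω (u ω) =
      ∑ s ∈ S, (u ⁻¹' {s}).indicator W ω * F ω s := by
    intro F ω
    rw [Finset.sum_eq_single (u ω)]
    · simp
    · intro s _ hs
      rw [Set.indicator_of_notMem (by simpa using hs.symm), zero_mul]
    · intro h
      exact absurd (huS ω) h
  have h1 := hsum fun ω s => ENNReal.ofReal (Real.exp (s * η ω - s ^ 2 * R ^ 2 / 2))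
  have h2 := hsum fun _ _ => 1
  simp only [mul_one] at h2
  simp only [h1]
  have hWs' : ∀ s : ℝ, Measurable ((u ⁻¹' {s}).indicator W) := fun s => (hWs s).mono h𝓖 le_rfl
  have hWZ : ∀ s : ℝ, Measurable fun ω => (u ⁻¹' {s}).indicator W ω *
      ENNReal.ofReal (Real.exp (s * η ω - s ^ 2 * R ^ 2 / 2)) := fun s =>
    (hWs' s).mul (by fun_prop)
  rw [lintegral_finsetSum _ fun s _ => hWZ s]
  conv_rhs => simp only [h2]
  rw [lintegral_finsetSum _ fun s _ => hWs' s]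
  exact Finset.sum_le_sum fun s _ => lintegral_mul_exp_const_le h𝓖 hη hsub s (hWs s)

/-- The null set in `IsCondSubGaussian` depends on s, so a random u cannot simply be substituted.
Finitely valued u are handled by splitting over the values; the general case follows by simple
approximation and Fatou's lemma. -/
theorem lintegral_mul_exp_le (h𝓖 : 𝓖 ≤ mΩ) (hη : Measurable η)
    (hsub : IsCondSubGaussian P 𝓖 η R) {W : Ω → ℝ≥0∞} (hW : Measurable[𝓖] W)
    {u : Ω → ℝ} (hu : Measurable[𝓖] u) :
    ∫⁻ ω, W ω * ENNReal.ofReal (Real.exp (u ω * η ω - u ω ^ 2 * R ^ 2 / 2)) ∂P ≤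
      ∫⁻ ω, W ω ∂P := by
  have hus : StronglyMeasurable[𝓖] u := hu.stronglyMeasurable
  have hWm : Measurable W := hW.mono h𝓖 le_rfl
  have hum' : ∀ n, Measurable[𝓖] (hus.approx n) := fun n => @SimpleFunc.measurable _ _ 𝓖 _ _
  have hum : ∀ n, Measurable (hus.approx n) := fun n => (hum' n).mono h𝓖 le_rfl
  have hlim : ∀ ω, Filter.liminf (fun n => W ω *
      ENNReal.ofReal (Real.exp (hus.approx n ω * η ω - hus.approx n ω ^ 2 * R ^ 2 / 2)))
        Filter.atTop =
      W ω * ENNReal.ofReal (Real.exp (u ω * η ω - u ω ^ 2 * R ^ 2 / 2)) := by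
    intro ω
    apply Filter.Tendsto.liminf_eq
    refine ENNReal.Tendsto.const_mul (ENNReal.tendsto_ofReal ?_)
      (Or.inl (by simpa using Real.exp_pos _))
    have hc : Continuous fun r : ℝ => Real.exp (r * η ω - r ^ 2 * R ^ 2 / 2) := by fun_prop
    exact (hc.tendsto _).comp (hus.tendsto_approx ω)
  simp only [← hlim]
  have hmeas : ∀ n, Measurable fun ω => W ω *
      ENNReal.ofReal (Real.exp (hus.approx n ω * η ω - hus.approx n ω ^ 2 * R ^ 2 / 2)) := by
    intro n
    have := hum n
    fun_prop
  refine (lintegral_liminf_le hmeas).trans ?_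
  refine Filter.liminf_le_of_le (by isBoundedDefault) fun b hb => ?_
  obtain ⟨n, hn⟩ := hb.exists
  exact hn.trans (lintegral_mul_exp_le_of_finite h𝓖 hη hsub hW (hum' n) _
      (@SimpleFunc.mem_range_self _ _ 𝓖 (hus.approx n)))

/-- The function e^η + e^(-η) - 2 is nonnegative, has integral at most 0, and vanishes only where η
= 0. -/
theorem ae_eq_zero_of_isCondSubGaussian_zero (h𝓖 : 𝓖 ≤ mΩ)
    (hsub : IsCondSubGaussian P 𝓖 η 0) : ∀ᵐ ω ∂P, η ω = 0 := by
  have key : ∀ s : ℝ, ∫ ω, Real.exp (s * η ω) ∂P ≤ 1 := by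
    intro s
    obtain ⟨-, hle⟩ := hsub s
    rw [← integral_condExp h𝓖]
    calc _ ≤ ∫ _, (1 : ℝ) ∂P := by
          refine integral_mono_ae integrable_condExp (integrable_const _) ?_
          filter_upwards [hle] with ω hω
          simpa using hω
      _ = 1 := by simp
  have h1 := (hsub 1).1
  have h2 := (hsub (-1)).1
  have hsum : ∀ ω, 0 ≤ (Real.exp (1 * η ω) - 1 - η ω) + (Real.exp (-1 * η ω) - 1 + η ω) := by
    intro ω
    have h3 := Real.add_one_le_exp (1 * η ω)
    have h4 := Real.add_one_le_exp (-1 * η ω)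
    linarith
  set q : Ω → ℝ := fun ω => Real.exp (1 * η ω) + Real.exp (-1 * η ω) - 2 with hq
  have hnn : 0 ≤ q := fun ω => by
    have := hsum ω
    simp only [hq, Pi.zero_apply]
    linarith
  have h12 : Integrable (fun ω => Real.exp (1 * η ω) + Real.exp (-1 * η ω)) P := h1.add h2
  have hqi : Integrable q P := h12.sub (integrable_const 2)
  have hq0 : ∫ ω, q ω ∂P ≤ 0 := by
    rw [hq, integral_sub h12 (integrable_const 2), integral_add h1 h2]
    simp only [integral_const, probReal_univ, one_smul]
    linarith [key 1, key (-1)]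
  have h3 := (integral_eq_zero_iff_of_nonneg hnn hqi).1 (le_antisymm hq0 (integral_nonneg hnn))
  filter_upwards [h3] with ω hω
  by_contra hne
  have h4 := Real.add_one_lt_exp hne
  have h5 := Real.add_one_le_exp (-1 * η ω)
  simp only [hq, one_mul, Pi.zero_apply] at hω
  linarith

end SubGaussian

/-! ### Ville's inequality -/

section Ville

variable {Ω : Type*} {mΩ : MeasurableSpace Ω} {P : Measure Ω}

/-- Ville's maximal inequality for a nonnegative supermartingale with finite horizon. -/
theorem mul_measure_compl_forall_lt_le (ℱ : Filtration ℕ mΩ) (M : ℕ → Ω → ℝ≥0∞) (c : ℝ≥0∞)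
    (T : ℕ) (hM : ∀ t ≤ T, Measurable[ℱ t] (M t))
    (hstep : ∀ t < T, ∀ A, MeasurableSet[ℱ t] A → ∫⁻ ω in A, M (t + 1) ω ∂P ≤ ∫⁻ ω in A, M t ω ∂P) :
    c * P {ω | ∀ t ≤ T, M t ω < c}ᶜ ≤ ∫⁻ ω, M 0 ω ∂P := by
  have hAm : ∀ t ≤ T, MeasurableSet[ℱ t] {ω | ∀ i ≤ t, M i ω < c} := by
    intro t ht
    have : {ω | ∀ i ≤ t, M i ω < c} = ⋂ i ∈ Set.Iic t, {ω | M i ω < c} := by ext; simp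
    rw [this]
    refine MeasurableSet.biInter (Set.to_countable _) fun i hi => ?_
    exact ((hM i (hi.trans ht)).mono (ℱ.mono hi) le_rfl) measurableSet_Iio
  have split : ∀ t ≤ T, ∀ S : Set Ω, MeasurableSet S →
      c * P (S ∩ {ω | M t ω < c}ᶜ) + ∫⁻ ω in S ∩ {ω | M t ω < c}, M t ω ∂P ≤
        ∫⁻ ω in S, M t ω ∂P := by
    intro t ht S hS
    have hMt : Measurable (M t) := (hM t ht).mono (ℱ.le t) le_rfl
    have hlt : MeasurableSet {ω | M t ω < c} := hMt measurableSet_Iio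
    rw [← lintegral_inter_add_sdiff (μ := P) (M t) S hlt, add_comm]
    gcongr
    rw [Set.sdiff_eq, ← setLIntegral_const]
    exact setLIntegral_mono hMt fun ω hω => not_lt.1 hω.2
  -- Supermartingale bound for the process stopped on reaching c: outcomes already stopped count c
  -- each, the others their current value.
  have main : ∀ t ≤ T, c * P {ω | ∀ i ≤ t, M i ω < c}ᶜ +
      ∫⁻ ω in {ω | ∀ i ≤ t, M i ω < c}, M t ω ∂P ≤ ∫⁻ ω, M 0 ω ∂P := by
    intro t
    induction t with
    | zero =>
      intro ht
      simpa using split 0 ht Set.univ MeasurableSet.univ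
    | succ t ih =>
      intro ht
      have ht' : t ≤ T := by omega
      set A := {ω | ∀ i ≤ t, M i ω < c} with hA
      have hsucc : {ω | ∀ i ≤ t + 1, M i ω < c} = A ∩ {ω | M (t + 1) ω < c} := by
        ext ω
        simp only [hA, Set.mem_ofPred_eq, Set.mem_inter_iff]
        refine ⟨fun h => ⟨fun i hi => h i (by omega), h _ le_rfl⟩, fun h i hi => ?_⟩
        rcases Nat.le_succ_iff.1 hi with hi | rfl
        · exact h.1 i hi
        · exact h.2
      have hAmeas : MeasurableSet A := ℱ.le t _ (hAm t ht')
      have hcompl : P (A ∩ {ω | M (t + 1) ω < c})ᶜ ≤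
          P Aᶜ + P (A ∩ {ω | M (t + 1) ω < c}ᶜ) := by
        refine (measure_mono ?_).trans (measure_union_le _ _)
        intro ω hω
        by_cases hωA : ω ∈ A
        · exact Or.inr ⟨hωA, fun h => hω ⟨hωA, h⟩⟩
        · exact Or.inl hωA
      rw [hsucc]
      calc _ ≤ c * (P Aᶜ + P (A ∩ {ω | M (t + 1) ω < c}ᶜ)) +
            ∫⁻ ω in A ∩ {ω | M (t + 1) ω < c}, M (t + 1) ω ∂P := by gcongr
        _ = c * P Aᶜ + (c * P (A ∩ {ω | M (t + 1) ω < c}ᶜ) +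
            ∫⁻ ω in A ∩ {ω | M (t + 1) ω < c}, M (t + 1) ω ∂P) := by rw [mul_add, add_assoc]
        _ ≤ c * P Aᶜ + ∫⁻ ω in A, M (t + 1) ω ∂P := by
            gcongr
            exact split (t + 1) ht A hAmeas
        _ ≤ c * P Aᶜ + ∫⁻ ω in A, M t ω ∂P := by
            gcongr 1
            exact hstep t (by omega) A (hAm t ht')
        _ ≤ _ := ih ht'
  exact le_self_add.trans (main T le_rfl)

end Ville

/-! ### Measurability of the posterior quantities -/

section Measurability

variable {Ω : Type*} {mΩ : MeasurableSpace Ω} {n : ℕ}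

theorem measurable_matrix_det {A : Ω → Matrix (Fin n) (Fin n) ℝ}
    (hA : ∀ i j, Measurable fun ω => A ω i j) : Measurable fun ω => (A ω).det := by
  simp only [Matrix.det_apply]
  fun_prop

theorem measurable_matrix_inv {A : Ω → Matrix (Fin n) (Fin n) ℝ}
    (hA : ∀ i j, Measurable fun ω => A ω i j) (i j : Fin n) :
    Measurable fun ω => (A ω)⁻¹ i j := by
  have hadj : Measurable fun ω => (A ω).adjugate i j := by
    simp only [Matrix.adjugate_apply]
    refine measurable_matrix_det fun a b => ?_
    by_cases h : a = j
    · subst h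
      simp
    · simpa [Matrix.updateRow_ne h] using hA a b
  simp only [Matrix.inv_def, Matrix.smul_apply, Ring.inverse_eq_inv', smul_eq_mul]
  exact (measurable_matrix_det hA).inv.mul hadj

theorem measurable_dotProduct {v w : Ω → Fin n → ℝ} (hv : ∀ i, Measurable fun ω => v ω i)
    (hw : ∀ i, Measurable fun ω => w ω i) : Measurable fun ω => v ω ⬝ᵥ w ω := by
  simp only [dotProduct]
  fun_prop

theorem measurable_mulVec {A : Ω → Matrix (Fin n) (Fin n) ℝ} {v : Ω → Fin n → ℝ}
    (hA : ∀ i j, Measurable fun ω => A ω i j) (hv : ∀ i, Measurable fun ω => v ω i) (i : Fin n) :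
    Measurable fun ω => (A ω).mulVec (v ω) i :=
  measurable_dotProduct (hA i) hv

variable {X H : Type*} [MeasurableSpace X] [NormedAddCommGroup H] [InnerProductSpace ℝ H]
  [CompleteSpace H] [RKHS ℝ H X ℝ] {lam : ℝ} {ξ : Ω → Fin n → X}

theorem measurable_regGram (hk : Measurable fun p : X × X => kern H p.1 p.2)
    (hξ : ∀ i, Measurable fun ω => ξ ω i) (i j : Fin n) :
    Measurable fun ω => regGram (kern H) lam (ξ ω) i j := by
  simp only [regGram, gram, Matrix.add_apply, Matrix.of_apply]
  exact (hk.comp ((hξ i).prodMk (hξ j))).add_const _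

theorem measurable_kvec (hk : Measurable fun p : X × X => kern H p.1 p.2)
    (hξ : ∀ i, Measurable fun ω => ξ ω i) {z : Ω → X} (hz : Measurable z) (i : Fin n) :
    Measurable fun ω => kvec (kern H) (ξ ω) (z ω) i := by
  have h := hk.comp ((hξ i).prodMk hz)
  simpa only [kvec, Function.comp_def] using h

theorem measurable_weights (hk : Measurable fun p : X × X => kern H p.1 p.2)
    (hξ : ∀ i, Measurable fun ω => ξ ω i) {z : Ω → X} (hz : Measurable z) (i : Fin n) :
    Measurable fun ω => weights H lam (ξ ω) (z ω) i :=
  measurable_mulVec (measurable_matrix_inv (measurable_regGram hk hξ))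
    (measurable_kvec hk hξ hz) i

theorem measurable_postCov_self (hk : Measurable fun p : X × X => kern H p.1 p.2)
    (hξ : ∀ i, Measurable fun ω => ξ ω i) {z : Ω → X} (hz : Measurable z) :
    Measurable fun ω => postCov (kern H) lam (ξ ω) (z ω) (z ω) :=
  (hk.comp (hz.prodMk hz)).sub
    (measurable_dotProduct (measurable_kvec hk hξ hz) (measurable_weights hk hξ hz))

theorem measurable_noiseEnergy (hk : Measurable fun p : X × X => kern H p.1 p.2)
    (hξ : ∀ i, Measurable fun ω => ξ ω i) {v : Ω → Fin n → ℝ} (hv : ∀ i, Measurable fun ω => v ω i) :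
    Measurable fun ω => noiseEnergy (kern H) lam (ξ ω) (v ω) :=
  (measurable_dotProduct hv hv).sub ((measurable_dotProduct hv (measurable_mulVec
    (measurable_matrix_inv (measurable_regGram hk hξ)) hv)).const_mul lam)

end Measurability

/-! ### The self-normalized process -/

section SelfNormalized

variable {X H : Type*} [NormedAddCommGroup H] [InnerProductSpace ℝ H] [CompleteSpace H]
  [RKHS ℝ H X ℝ] {lam R : ℝ} {n : ℕ}

/-- The self-normalized process
`det (I + K / λ) ^ (-1/2) * exp (ηᵀ K (K + λ I)⁻¹ η / (2 R²))`. -/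
noncomputable def selfNormalized (k : X → X → ℝ) (lam R : ℝ) (x : Fin n → X) (η : Fin n → ℝ) : ℝ :=
  √(lam ^ n / (regGram k lam x).det) * Real.exp (noiseEnergy k lam x η / (2 * R ^ 2))

theorem selfNormalized_nonneg (k : X → X → ℝ) (x : Fin n → X) (η : Fin n → ℝ) :
    0 ≤ selfNormalized k lam R x η := by
  unfold selfNormalized
  positivity

theorem selfNormalized_zero (k : X → X → ℝ) (x : Fin 0 → X) (η : Fin 0 → ℝ) :
    selfNormalized k lam R x η = 1 := by
  simp [selfNormalized, noiseEnergy]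

theorem selfNormalized_snoc (hlam : 0 < lam) (x : Fin n → X) (z : X) (v : Fin n → ℝ) (e : ℝ) :
    selfNormalized (kern H) lam R (Fin.snoc x z : Fin (n + 1) → X) (Fin.snoc v e) =
      selfNormalized (kern H) lam R x v *
        (√(lam / (postCov (kern H) lam x z z + lam)) *
          Real.exp ((e ^ 2 - lam * (e - weights H lam x z ⬝ᵥ v) ^ 2 /
            (postCov (kern H) lam x z z + lam)) / (2 * R ^ 2))) := by
  have hs := postCov_self_nonneg (H := H) hlam x z
  have hd := det_regGram_pos (H := H) hlam x
  rw [selfNormalized, selfNormalized, noiseEnergy_snoc hlam, det_regGram_snoc hlam, pow_succ,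
    mul_div_mul_comm, Real.sqrt_mul (by positivity), add_div, Real.exp_add]
  ring

theorem noiseEnergy_le_of_selfNormalized_lt (hlam : 0 < lam) (hR : 0 < R) {ζ : ℝ}
    (x : Fin n → X) (η : Fin n → ℝ) (h : selfNormalized (kern H) lam R x η < 1 / ζ) :
    noiseEnergy (kern H) lam x η ≤
      R ^ 2 * (Real.log ((regGram (kern H) lam x).det / lam ^ n) + 2 * Real.log (1 / ζ)) := by
  have hd := det_regGram_pos (H := H) hlam x
  have hq : 0 < lam ^ n / (regGram (kern H) lam x).det := by positivity
  rw [selfNormalized] at h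
  have h1 := (Real.log_lt_log (by positivity) h).le
  rw [Real.log_mul (Real.sqrt_pos.2 hq).ne' (Real.exp_pos _).ne', Real.log_exp,
    Real.log_sqrt hq.le, ← inv_div _ (lam ^ n), Real.log_inv] at h1
  have h2 : noiseEnergy (kern H) lam x η / (2 * R ^ 2) ≤
      Real.log ((regGram (kern H) lam x).det / lam ^ n) / 2 + Real.log (1 / ζ) := by linarith
  rw [div_le_iff₀ (by positivity)] at h2
  linarith

theorem past_succ {Ω A : Type*} (a : ℕ → Ω → A) (t : ℕ) (ω : Ω) :
    past a (t + 1) ω = Fin.snoc (past a t ω) (a t ω) := by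
  ext i
  refine Fin.lastCases ?_ (fun i => ?_) i <;> simp [past]

end SelfNormalized

/-! ### Supermartingale property and concentration of the noise energy -/

section Concentration

open ProbabilityTheory Filter

variable {X H : Type*} [MeasurableSpace X] [NormedAddCommGroup H] [InnerProductSpace ℝ H]
  [CompleteSpace H] [RKHS ℝ H X ℝ] {lam R : ℝ}
  {Ω : Type*} {mΩ : MeasurableSpace Ω} {P : Measure Ω} [IsProbabilityMeasure P]
  {ℱ : Filtration ℕ mΩ} {T : ℕ} {x : ℕ → Ω → X} {η : ℕ → Ω → ℝ}

theorem measurable_past_of_adapted {A : Type*} [MeasurableSpace A] {a : ℕ → Ω → A} {t : ℕ}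
    (ht : t ≤ T) (ha : ∀ i < T, Measurable[ℱ (i + 1)] (a i)) (i : Fin t) :
    Measurable[ℱ t] fun ω => past a t ω i :=
  (ha i (i.2.trans_le ht)).mono (ℱ.mono i.2) le_rfl

theorem measurable_selfNormalized (hk : Measurable fun p : X × X => kern H p.1 p.2)
    (hx : ∀ t < T, Measurable[ℱ t] (x t)) (hη : ∀ t < T, Measurable[ℱ (t + 1)] (η t))
    {t : ℕ} (ht : t ≤ T) :
    Measurable[ℱ t] fun ω => selfNormalized (kern H) lam R (past x t ω) (past η t ω) := by
  have hx' := measurable_past_of_adapted (ℱ := ℱ) ht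
    fun i hi => (hx i hi).mono (ℱ.mono i.le_succ) le_rfl
  have hη' := measurable_past_of_adapted ht hη
  have h1 := measurable_matrix_det (measurable_regGram (lam := lam) hk hx')
  have h2 := measurable_noiseEnergy (lam := lam) hk hx' hη'
  exact (Real.continuous_sqrt.measurable.comp (h1.const_div _)).mul
    (Real.measurable_exp.comp (h2.div_const _))

/-- Write the new factor as a Gaussian mixture and exchange integrals by Tonelli. For each fixed g
the multiplier `u g` depends only on past noise and on points up to `x t`, hence is `ℱ
t`-measurable, and `lintegral_mul_exp_le` applies. -/
theorem setLIntegral_selfNormalized_succ_le (hk : Measurable fun p : X × X => kern H p.1 p.2)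
    (hlam : 0 < lam) (hR : 0 < R)
    (hx : ∀ t < T, Measurable[ℱ t] (x t)) (hη : ∀ t < T, Measurable[ℱ (t + 1)] (η t))
    (hsub : ∀ t < T, IsCondSubGaussian P (ℱ t) (η t) R) {t : ℕ} (ht : t < T)
    {A : Set Ω} (hA : MeasurableSet[ℱ t] A) :
    ∫⁻ ω in A, ENNReal.ofReal
        (selfNormalized (kern H) lam R (past x (t + 1) ω) (past η (t + 1) ω)) ∂P ≤
      ∫⁻ ω in A, ENNReal.ofReal
        (selfNormalized (kern H) lam R (past x t ω) (past η t ω)) ∂P := by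
  have hx' := measurable_past_of_adapted (ℱ := ℱ) ht.le
    fun i hi => (hx i hi).mono (ℱ.mono i.le_succ) le_rfl
  have hη' := measurable_past_of_adapted ht.le hη
  set s : Ω → ℝ := fun ω => postCov (kern H) lam (past x t ω) (x t ω) (x t ω) with hs
  set m : Ω → ℝ := fun ω => weights H lam (past x t ω) (x t ω) ⬝ᵥ past η t ω with hm
  have hsm : Measurable[ℱ t] s := measurable_postCov_self hk hx' (hx t ht)
  have hmm : Measurable[ℱ t] m :=
    measurable_dotProduct (measurable_weights hk hx' (hx t ht)) hη'
  have hs0 : ∀ ω, 0 ≤ s ω := fun ω => postCov_self_nonneg hlam _ _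
  set W : Ω → ℝ≥0∞ := A.indicator fun ω => ENNReal.ofReal
    (selfNormalized (kern H) lam R (past x t ω) (past η t ω)) with hW
  have hWm : Measurable[ℱ t] W :=
    (ENNReal.measurable_ofReal.comp (measurable_selfNormalized hk hx hη ht.le)).indicator hA
  set u : ℝ → Ω → ℝ := fun g ω => (m ω + R * √(s ω / lam) * g) / R ^ 2 with hu
  have hum : ∀ g, Measurable[ℱ t] (u g) := fun g =>
    (hmm.add (((Real.continuous_sqrt.measurable.comp (hsm.div_const _)).const_mul R).mul_const
      g)).div_const _
  have hηm : Measurable (η t) := (hη t ht).mono (ℱ.le _) le_rfl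
  have hWm' : Measurable W := hWm.mono (ℱ.le _) le_rfl
  have hsm' : Measurable s := hsm.mono (ℱ.le _) le_rfl
  have hmm' : Measurable m := hmm.mono (ℱ.le _) le_rfl
  have hpt : ∀ ω, A.indicator (fun ω => ENNReal.ofReal
      (selfNormalized (kern H) lam R (past x (t + 1) ω) (past η (t + 1) ω))) ω =
      ∫⁻ g, W ω * ENNReal.ofReal (Real.exp (u g ω * η t ω - u g ω ^ 2 * R ^ 2 / 2))
        ∂(gaussianReal 0 1) := by
    intro ω
    rw [lintegral_const_mul _ (by simp only [hu]; fun_prop)]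
    simp only [hu]
    rw [lintegral_exp_gaussianReal_mixture hlam (hs0 ω) hR]
    by_cases hω : ω ∈ A
    · simp only [hW, Set.indicator_of_mem hω, past_succ]
      rw [selfNormalized_snoc hlam, ENNReal.ofReal_mul (selfNormalized_nonneg _ _ _)]
    · simp [hW, Set.indicator_of_notMem hω]
  rw [← lintegral_indicator (ℱ.le t _ hA), ← lintegral_indicator (ℱ.le t _ hA)]
  simp only [hpt]
  rw [lintegral_lintegral_swap]
  · calc _ ≤ ∫⁻ _, ∫⁻ ω, W ω ∂P ∂(gaussianReal 0 1) :=
        lintegral_mono fun g => lintegral_mul_exp_le (ℱ.le t) hηm (hsub t ht) hWm (hum g)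
      _ = _ := by simp [hW]
  · refine Measurable.aemeasurable ?_
    simp only [hu, Function.uncurry_def]
    fun_prop

/-- With probability at least `1 - ζ`, the energy of the noise is controlled by the
log-determinant of the kernel matrix, uniformly in time. -/
theorem exists_event_noiseEnergy_le (hk : Measurable fun p : X × X => kern H p.1 p.2)
    (hlam : 0 < lam) (hR : 0 ≤ R) {ζ : ℝ} (hζ : ζ ∈ Set.Ioo (0 : ℝ) 1)
    (hx : ∀ t < T, Measurable[ℱ t] (x t)) (hη : ∀ t < T, Measurable[ℱ (t + 1)] (η t))
    (hsub : ∀ t < T, IsCondSubGaussian P (ℱ t) (η t) R) :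
    ∃ G : Set Ω, MeasurableSet G ∧ ENNReal.ofReal (1 - ζ) ≤ P G ∧ ∀ ω ∈ G, ∀ t < T,
      noiseEnergy (kern H) lam (past x t ω) (past η t ω) ≤
        R ^ 2 * (Real.log ((regGram (kern H) lam (past x t ω)).det / lam ^ t) +
          2 * Real.log (1 / ζ)) := by
  have hηm : ∀ t < T, Measurable (η t) := fun t ht => (hη t ht).mono (ℱ.le _) le_rfl
  -- The process divides by R², so R = 0 is separate: there the noise vanishes almost surely.
  rcases hR.eq_or_lt with rfl | hRpos
  · refine ⟨⋂ t ∈ Set.Iio T, {ω | η t ω = 0},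
      MeasurableSet.biInter (Set.to_countable _) fun t ht =>
        hηm t ht (measurableSet_singleton 0), ?_, ?_⟩
    · have hae : ∀ᵐ ω ∂P, ω ∈ ⋂ t ∈ Set.Iio T, {ω | η t ω = 0} := by
        simp only [Set.mem_iInter]
        refine (ae_ball_iff (Set.to_countable _)).2 fun t ht => ?_
        exact ae_eq_zero_of_isCondSubGaussian_zero (ℱ.le t) (hsub t ht)
      have hone : P (⋂ t ∈ Set.Iio T, {ω | η t ω = 0}) = 1 :=
        (measure_congr (eventuallyEq_univ.2 hae)).trans measure_univ
      rw [hone]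
      exact ENNReal.ofReal_le_one.2 (by linarith [hζ.1])
    · intro ω hω t ht
      have h0 : past η t ω = 0 := by
        ext i
        simp only [Set.mem_iInter] at hω
        exact hω i (Set.mem_Iio.2 (i.2.trans ht))
      simp [noiseEnergy, h0]
  · set M : ℕ → Ω → ℝ≥0∞ := fun t ω =>
      ENNReal.ofReal (selfNormalized (kern H) lam R (past x t ω) (past η t ω)) with hM
    have hMm : ∀ t ≤ T, Measurable[ℱ t] (M t) := fun t ht =>
      ENNReal.measurable_ofReal.comp (measurable_selfNormalized hk hx hη ht)
    have hV := mul_measure_compl_forall_lt_le (P := P) ℱ M (ENNReal.ofReal (1 / ζ)) T hMm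
      fun t ht A hA => setLIntegral_selfNormalized_succ_le hk hlam hRpos hx hη hsub ht hA
    set G : Set Ω := {ω | ∀ t ≤ T, M t ω < ENNReal.ofReal (1 / ζ)} with hG
    have hGm : MeasurableSet G := by
      have : G = ⋂ t ∈ Set.Iic T, {ω | M t ω < ENNReal.ofReal (1 / ζ)} := by ext; simp [hG]
      rw [this]
      exact MeasurableSet.biInter (Set.to_countable _) fun t ht =>
        ((hMm t ht).mono (ℱ.le t) le_rfl) measurableSet_Iio
    refine ⟨G, hGm, ?_, ?_⟩
    · have h0 : ∫⁻ ω, M 0 ω ∂P = 1 := by simp [hM, selfNormalized_zero]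
      have h1 : P Gᶜ ≤ ENNReal.ofReal ζ := by
        rw [h0, one_div, ENNReal.ofReal_inv_of_pos hζ.1] at hV
        have hne : ENNReal.ofReal ζ ≠ 0 := by simpa using hζ.1
        calc P Gᶜ = ENNReal.ofReal ζ * ((ENNReal.ofReal ζ)⁻¹ * P Gᶜ) := by
              rw [← mul_assoc, ENNReal.mul_inv_cancel hne ENNReal.ofReal_ne_top, one_mul]
          _ ≤ ENNReal.ofReal ζ * 1 := by gcongr
          _ = _ := mul_one _
      rw [ENNReal.ofReal_sub _ hζ.1.le, ENNReal.ofReal_one, tsub_le_iff_right,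
        ← prob_add_prob_compl (μ := P) hGm]
      gcongr
    · intro ω hω t ht
      refine noiseEnergy_le_of_selfNormalized_lt hlam hRpos _ _ ?_
      exact (ENNReal.ofReal_lt_ofReal_iff (by simpa using hζ.1)).1 (hω t ht.le)

end Concentration

/-! ### The confidence band -/

section Confidence

variable {X H : Type*} [NormedAddCommGroup H] [InnerProductSpace ℝ H] [CompleteSpace H]
  [RKHS ℝ H X ℝ] {lam R B ζ : ℝ} {n : ℕ}

/-- The matrix in β is (K + λI) scaled by max(1, λ)/λ, so its determinant exceeds the one needed by
the factor max(1, λ)^n ≥ 1. -/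
theorem log_det_regGram_div_le (hlam : 0 < lam) (x : Fin n → X) :
    Real.log ((regGram (kern H) lam x).det / lam ^ n) ≤
      Real.log (((max 1 lam / lam) • gram (kern H) x +
        (max 1 lam) • (1 : Matrix (Fin n) (Fin n) ℝ)).det) := by
  have hd := det_regGram_pos (H := H) hlam x
  have h1 : (max 1 lam / lam) • gram (kern H) x + (max 1 lam) • (1 : Matrix (Fin n) (Fin n) ℝ) =
      (max 1 lam / lam) • regGram (kern H) lam x := by
    rw [regGram, smul_add, smul_smul, div_mul_cancel₀ _ hlam.ne']
  rw [h1, Matrix.det_smul, Fintype.card_fin, div_pow, div_mul_eq_mul_div]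
  refine Real.log_le_log (by positivity) ?_
  gcongr
  exact le_mul_of_one_le_left hd.le (one_le_pow₀ (le_max_left _ _))

theorem abs_sub_postMean_le (hlam : 0 < lam) (hR : 0 ≤ R) {f : H} (hf : ‖f‖ ≤ B)
    (x : Fin n → X) (η : Fin n → ℝ)
    (hE : noiseEnergy (kern H) lam x η ≤
      R ^ 2 * (Real.log ((regGram (kern H) lam x).det / lam ^ n) + 2 * Real.log (1 / ζ))) (z : X) :
    |f z - postMean (kern H) lam x (fun i => f (x i) + η i) z| ≤
      beta (kern H) lam B R ζ x * postStd (kern H) lam x z := by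
  set L := Real.log (((max 1 lam / lam) • gram (kern H) x +
        (max 1 lam) • (1 : Matrix (Fin n) (Fin n) ℝ)).det) + 2 * Real.log (1 / ζ) with hL
  have hE' : noiseEnergy (kern H) lam x η ≤ (R * √L) ^ 2 := by
    rw [mul_pow]
    refine hE.trans (mul_le_mul_of_nonneg_left ?_ (sq_nonneg R))
    refine (add_le_add_left (log_det_regGram_div_le hlam x) _).trans ?_
    rw [← hL]
    -- For L ≤ 0 the default value √L = 0 does no harm, as L itself is then at most 0.
    rcases le_total 0 L with h | h
    · rw [Real.sq_sqrt h]
    · exact h.trans (sq_nonneg _)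
  have h1 := abs_weights_dotProduct_le hlam x η z (mul_nonneg hR (Real.sqrt_nonneg L)) hE'
  have h2 := abs_sub_weights_dotProduct_le hlam x f z
  have h3 : ‖f‖ * postStd (kern H) lam x z ≤ B * postStd (kern H) lam x z :=
    mul_le_mul_of_nonneg_right hf (Real.sqrt_nonneg _)
  have h4 : postMean (kern H) lam x (fun i => f (x i) + η i) z =
      weights H lam x z ⬝ᵥ (fun i => f (x i)) + weights H lam x z ⬝ᵥ η := by
    rw [postMean_eq_weights, ← dotProduct_add]
    rfl
  rw [h4, ← sub_sub, beta, ← hL, add_mul, div_mul_eq_mul_div]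
  exact (abs_sub _ _).trans (add_le_add (h2.trans h3) h1)

end Confidence

/-! ### From confidence bounds to fragility guarantees -/

section Fragility

variable {m : ℕ} {𝒳 : Set (E m)} {d : 𝒳 → 𝒳 → ℝ} {g h : 𝒳 → ℝ} {τ : ℝ}

theorem zero_mem_ambiguityBall_top (d : 𝒳 → 𝒳 → ℝ) (x : 𝒳) : (0 : E m) ∈ ambiguityBall d ⊤ x :=
  ⟨x, by simp, le_top⟩

theorem sub_mem_ambiguityBall_top (d : 𝒳 → 𝒳 → ℝ) (x z : 𝒳) :
    (z : E m) - (x : E m) ∈ ambiguityBall d ⊤ x :=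
  ⟨z, rfl, le_top⟩

theorem perturb_zero {x : 𝒳} (h₀ : (0 : E m) ∈ ambiguityBall d ⊤ x) : perturb x 0 h₀ = x :=
  Subtype.ext (add_zero _)

theorem perturb_sub {x z : 𝒳} (h₀ : (z : E m) - (x : E m) ∈ ambiguityBall d ⊤ x) :
    perturb x _ h₀ = z :=
  Subtype.ext (add_sub_cancel _ _)

theorem fragilityRatio_le_fragility {x : 𝒳} {δ : E m} (hδ : δ ∈ ambiguityBall d ⊤ x)
    (hne : δ ≠ 0) : fragilityRatio d g τ x (perturb x δ hδ) ≤ fragility d g τ x := by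
  unfold fragility
  split_ifs with hx
  · exact le_max_of_le_left (le_iSup_of_le δ (le_iSup_of_le hδ (le_iSup_of_le hne le_rfl)))
  · exact le_top

theorem fragility_nonneg (x : 𝒳) : 0 ≤ fragility d g τ x := by
  unfold fragility
  split_ifs
  · exact le_max_right _ _
  · exact le_top

/-- A finite fragility for a lower bound of the reward is a robust satisficing guarantee. -/
theorem le_of_fragility_ne_top (hd : IsPseudometric d) (hgh : ∀ z, g z ≤ h z) {x : 𝒳}
    (hfin : fragility d g τ x ≠ ⊤) {δ : E m} (hδ : δ ∈ ambiguityBall d ⊤ x) :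
    (τ : EReal) - fragility d g τ x * (d x (perturb x δ hδ) : EReal) ≤
      (h (perturb x δ hδ) : EReal) := by
  have hτx : τ ≤ g x := by
    by_contra hlt
    exact hfin (by simp [fragility, hlt])
  have hnn := fragility_nonneg (d := d) (g := g) (τ := τ) x
  have hreal : ∃ κ : ℝ, 0 ≤ κ ∧ fragility d g τ x = (κ : EReal) := by
    lift fragility d g τ x to ℝ using ⟨hfin, fun hb => by simp [hb] at hnn⟩ with κ
    exact ⟨κ, by exact_mod_cast hnn, rfl⟩
  obtain ⟨κ, hκ, hκeq⟩ := hreal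
  suffices hs : τ - κ * d x (perturb x δ hδ) ≤ g (perturb x δ hδ) by
    rw [hκeq]
    exact_mod_cast hs.trans (hgh _)
  by_cases hne : δ = 0
  · subst hne
    simpa [perturb_zero, hd.self] using hτx
  · have hratio := fragilityRatio_le_fragility (d := d) (g := g) (τ := τ) hδ hne
    rw [hκeq, fragilityRatio] at hratio
    -- At distance 0 the ratio ⊤ would contradict finiteness, and ⊥ already means g ≥ τ there.
    split_ifs at hratio with h0 hlt
    · exact absurd hratio (by simp)
    · rw [h0]
      linarith
    · have hpos : 0 < d x (perturb x δ hδ) := lt_of_le_of_ne (hd.nonneg _ _) (Ne.symm h0)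
      have hle : (τ - g (perturb x δ hδ)) / d x (perturb x δ hδ) ≤ κ := by exact_mod_cast hratio
      rw [div_le_iff₀ hpos] at hle
      linarith

theorem fragility_eq_zero_of_forall_le (hd : IsPseudometric d) (hg : ∀ z, τ ≤ g z) (x : 𝒳) :
    fragility d g τ x = 0 := by
  rw [fragility, if_pos (hg x)]
  refine max_eq_right (iSup_le fun δ => iSup_le fun hδ => iSup_le fun _ => ?_)
  rw [fragilityRatio]
  split_ifs with h0 hlt
  · exact absurd hlt (not_lt.2 (hg _))
  · exact bot_le
  · exact_mod_cast div_nonpos_of_nonpos_of_nonneg (sub_nonpos.2 (hg _)) (hd.nonneg _ _)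

theorem fragilityRatio_pos (hd : IsPseudometric d) (x : 𝒳) {z : 𝒳} (hz : g z < τ) :
    0 < fragilityRatio d g τ x z := by
  rw [fragilityRatio]
  split_ifs with h0
  · exact EReal.zero_lt_top
  · have hpos : 0 < d x z := lt_of_le_of_ne (hd.nonneg _ _) (Ne.symm h0)
    exact_mod_cast div_pos (sub_pos.2 hz) hpos

/-- The fragility is the ratio at a maximizing perturbation, if some point is below the
threshold. -/
theorem exists_fragility_eq_fragilityRatio (hd : IsPseudometric d) {x z : 𝒳} (hx : τ < g x)
    (hz : g z < τ) (hmax : FragilityMaxAttained d g τ x) :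
    ∃ (δ : E m) (hδ : δ ∈ ambiguityBall d ⊤ x),
      fragility d g τ x = fragilityRatio d g τ x (perturb x δ hδ) ∧
        0 < fragilityRatio d g τ x (perturb x δ hδ) := by
  obtain ⟨δ, hδ, hne, hle⟩ := hmax
  -- This perturbation competes in the maximum and has a positive ratio, so the positive part
  -- changes nothing.
  have hzx : (z : E m) - (x : E m) ≠ 0 := by
    intro h0
    have : z = x := Subtype.ext (sub_eq_zero.1 h0)
    subst this
    exact lt_asymm hx hz
  have hpos : 0 < fragilityRatio d g τ x (perturb x δ hδ) := by
    refine lt_of_lt_of_le ?_ (hle _ (sub_mem_ambiguityBall_top d x z) hzx)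
    rw [perturb_sub]
    exact fragilityRatio_pos hd x hz
  refine ⟨δ, hδ, le_antisymm ?_ (fragilityRatio_le_fragility hδ hne), hpos⟩
  rw [fragility, if_pos hx.le]
  exact max_le (iSup_le fun δ' => iSup_le fun hδ' => iSup_le fun hne' => hle δ' hδ' hne') hpos.le

/-- For an upper bound of the reward, some perturbation makes the fragility bound tight. -/
theorem exists_le_sub_fragility_mul (hd : IsPseudometric d) (hhg : ∀ z, h z ≤ g z) {x : 𝒳}
    (hmax : τ < g x → (∃ z, g z < τ) → FragilityMaxAttained d g τ x) (hh : ∃ z, h z ≤ τ) :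
    ∃ (δ : E m) (hδ : δ ∈ ambiguityBall d ⊤ x), (h (perturb x δ hδ) : EReal) ≤
      (τ : EReal) - fragility d g τ x * (d x (perturb x δ hδ) : EReal) := by
  rcases le_or_gt (g x) τ with hle | hlt
  -- No perturbation is needed; if the fragility is ⊤, the convention ⊤ * 0 = 0 applies.
  · refine ⟨0, zero_mem_ambiguityBall_top d x, ?_⟩
    rw [perturb_zero, hd.self]
    simpa using (hhg x).trans hle
  by_cases hz : ∃ z, g z < τ
  · obtain ⟨z, hz'⟩ := hz
    obtain ⟨δ, hδ, heq, hpos⟩ := exists_fragility_eq_fragilityRatio hd hlt hz' (hmax hlt ⟨z, hz'⟩)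
    refine ⟨δ, hδ, ?_⟩
    rw [heq]
    rw [fragilityRatio] at hpos ⊢
    split_ifs at hpos ⊢ with h0 h1
    · rw [h0]
      simpa using (hhg _).trans h1.le
    · exact absurd hpos (by simp)
    -- With nonzero distance, ratio times distance is τ - g, so the right side is exactly g at the
    -- maximizer.
    · rw [← EReal.coe_mul, ← EReal.coe_sub, EReal.coe_le_coe_iff, div_mul_cancel₀ _ h0,
        sub_sub_cancel]
      exact hhg _
  -- With g ≥ τ everywhere the fragility is 0, and the given point with h ≤ τ is the witness.
  · simp only [not_exists, not_lt] at hz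
    obtain ⟨z, hzh⟩ := hh
    refine ⟨_, sub_mem_ambiguityBall_top d x z, ?_⟩
    rw [fragility_eq_zero_of_forall_le hd hz, perturb_sub]
    simpa using hzh

end Fragility

end AdveRS

theorem mainTheorem6 {m : ℕ} {𝒳 : Set (AdveRS.E m)}
    {H : Type*} [NormedAddCommGroup H] [InnerProductSpace ℝ H] [CompleteSpace H] [RKHS ℝ H 𝒳 ℝ]
    (hk : Measurable fun p : 𝒳 × 𝒳 => AdveRS.kern H p.1 p.2)
    (d : 𝒳 → 𝒳 → ℝ) (hd : AdveRS.IsPseudometric d)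
    {B R lam ζ τ : ℝ} (hR : 0 ≤ R) (hlam : 0 < lam) (hζ : ζ ∈ Set.Ioo (0 : ℝ) 1)
    (f : H) (hf : ‖f‖ ≤ B)
    (hτ : ∃ x : 𝒳, τ ≤ f x)
    {Ω : Type*} {mΩ : MeasurableSpace Ω} (P : Measure Ω) [IsProbabilityMeasure P]
    (ℱ : Filtration ℕ mΩ) (T : ℕ) (ε : ℕ → ℝ≥0∞)
    (xsel : ℕ → Ω → 𝒳) (δ : ℕ → Ω → AdveRS.E m) (x : ℕ → Ω → 𝒳) (η y : ℕ → Ω → ℝ)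
    (hx : ∀ t < T, Measurable[ℱ t] (x t))
    (hη : ∀ t < T, Measurable[ℱ (t + 1)] (η t))
    (hsub : ∀ t < T, AdveRS.IsCondSubGaussian P (ℱ t) (η t) R)
    (hrun : AdveRS.IsAdveRS1Run d (AdveRS.kern H) lam B R ζ τ f T ε xsel δ x η y)
    (hmax : ∀ t < T, ∀ ω,
      τ < AdveRS.ucbAt (AdveRS.kern H) lam B R ζ x y t ω (xsel t ω) →
      (∃ z : 𝒳, AdveRS.ucbAt (AdveRS.kern H) lam B R ζ x y t ω z < τ) →
      AdveRS.FragilityMaxAttained d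
        (AdveRS.ucbAt (AdveRS.kern H) lam B R ζ x y t ω) τ (xsel t ω)) :
    ∃ G : Set Ω, MeasurableSet G ∧ ENNReal.ofReal (1 - ζ) ≤ P G ∧
      ∀ ω ∈ G, ∀ t < T,
        (AdveRS.fragility d (AdveRS.lcbAt (AdveRS.kern H) lam B R ζ x y t ω) τ (xsel t ω) ≠ ⊤ →
          ∀ (δ₀ : AdveRS.E m) (h₀ : δ₀ ∈ AdveRS.ambiguityBall d ⊤ (xsel t ω)),
            (τ : EReal) -
                AdveRS.fragility d (AdveRS.lcbAt (AdveRS.kern H) lam B R ζ x y t ω) τ (xsel t ω) *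
                  (d (xsel t ω) (AdveRS.perturb (xsel t ω) δ₀ h₀) : EReal) ≤
              (f (AdveRS.perturb (xsel t ω) δ₀ h₀) : EReal)) ∧
        ((∃ z : 𝒳, f z ≤ τ) →
          ∃ (δ₁ : AdveRS.E m) (h₁ : δ₁ ∈ AdveRS.ambiguityBall d ⊤ (xsel t ω)),
            (f (AdveRS.perturb (xsel t ω) δ₁ h₁) : EReal) ≤
              (τ : EReal) -
                (⨅ z : 𝒳, AdveRS.fragility d
                    (AdveRS.ucbAt (AdveRS.kern H) lam B R ζ x y t ω) τ z) *
                  (d (xsel t ω) (AdveRS.perturb (xsel t ω) δ₁ h₁) : EReal)) := by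
  obtain ⟨G, hGm, hPG, hG⟩ := AdveRS.exists_event_noiseEnergy_le hk hlam hR hζ hx hη hsub
  refine ⟨G, hGm, hPG, fun ω hω t ht => ?_⟩
  have hy : AdveRS.past y t ω =
      fun i => f (AdveRS.past x t ω i) + AdveRS.past η t ω i :=
    funext fun i => hrun.observe i (i.2.trans ht) ω
  have hconf : ∀ z : 𝒳, |f z - AdveRS.postMean (AdveRS.kern H) lam (AdveRS.past x t ω)
      (AdveRS.past y t ω) z| ≤ AdveRS.beta (AdveRS.kern H) lam B R ζ (AdveRS.past x t ω) *
        AdveRS.postStd (AdveRS.kern H) lam (AdveRS.past x t ω) z := by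
    rw [hy]
    exact AdveRS.abs_sub_postMean_le hlam hR hf _ _ (hG ω hω t ht)
  have hlcb : ∀ z : 𝒳, AdveRS.lcbAt (AdveRS.kern H) lam B R ζ x y t ω z ≤ f z := by
    intro z
    have := (abs_le.1 (hconf z)).1
    simp only [AdveRS.lcbAt, AdveRS.lcb]
    linarith
  have hucb : ∀ z : 𝒳, f z ≤ AdveRS.ucbAt (AdveRS.kern H) lam B R ζ x y t ω z := by
    intro z
    have := (abs_le.1 (hconf z)).2
    simp only [AdveRS.ucbAt, AdveRS.ucb]
    linarith
  refine ⟨fun hfin δ₀ h₀ => AdveRS.le_of_fragility_ne_top hd hlcb hfin h₀, fun hz => ?_⟩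
  -- Only here does the selection rule enter: the infimum is attained at the chosen action.
  have hinf : (⨅ z : 𝒳, AdveRS.fragility d
      (AdveRS.ucbAt (AdveRS.kern H) lam B R ζ x y t ω) τ z) =
      AdveRS.fragility d (AdveRS.ucbAt (AdveRS.kern H) lam B R ζ x y t ω) τ (xsel t ω) :=
    le_antisymm (iInf_le _ _) (le_iInf (hrun.select t ht ω))
  rw [hinf]
  exact AdveRS.exists_le_sub_fragility_mul hd hucb (hmax t ht ω) hz
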